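/- Let $d \in \mathbb{N}$, $p \in [1,\infty)$ and $\sigma \in [0,\infty)$. Let $\mathcal{P}_p$ be the set of Borel probability measures $\mu$ on $\mathbb{R}^d$ with $\int |x|^p \, d\mu(x) < \infty$, where $|\cdot|$ is the Euclidean norm. For Borel probability measures $\mu,\nu$ on $\mathbb{R}^d$ let $$W_p(\mu,\nu) = \Big( \inf_{\pi \in \Pi(\mu,\nu)} \int |x-y|^p \, d\pi(x,y) \Big)^{1/p},$$ where $\Pi(\mu,\nu)$ is the set of couplings of $\mu$ and $\nu$ (measures on $\mathbb{R}^d\times\mathbb{R}^d$ with marginals $\mu$ and $\nu$), and let $$W_p^{(\sigma)}(\mu,\nu) = W_p(\mu * \mathcal{N}_\sigma, \nu * \mathcal{N}_\sigma), \qquad \mathcal{N}_\sigma = \mathcal{N}(0,\sigma^2 \mathrm{I}_d),$$ where $*$ denotes convolution of measures and $\mathcal{N}_0 = \delta_0$. Then $W_p$ and $W_p^{(\sigma)}$ are (finite) metrics on $\mathcal{P}_p$, and $W_p^{(\sigma)}$ induces the same topology on $\mathcal{P}_p$ as $W_p$. This topology is that of weak convergence together with convergence of $p$-th moments, i.e.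 the coarsest topology on $\mathcal{P}_p$ that is finer than the topology of weak convergence and makes $\mu \mapsto \int |x|^p \, d\mu(x)$ continuous. -/

import Mathlib

open MeasureTheory ProbabilityTheory Filter Topology
open scoped ENNReal

namespace SmoothWasserstein

/-- The `p`-th absolute moment `∫ |x|^p dμ(x)` of a measure on `ℝ^d`, with values in `[0, ∞]`. -/
noncomputable def moment {d : ℕ} (p : ℝ) (μ : Measure (EuclideanSpace ℝ (Fin d))) : ℝ≥0∞ :=
  ∫⁻ x, ‖x‖ₑ ^ p ∂μ

/-- `𝒫_p`: the Borel probability measures on `ℝ^d` with finite `p`-th moment. -/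
def Pp (d : ℕ) (p : ℝ) : Type :=
  {μ : ProbabilityMeasure (EuclideanSpace ℝ (Fin d)) //
    moment p (μ : Measure (EuclideanSpace ℝ (Fin d))) < ∞}

/-- The underlying probability measure of an element of `𝒫_p`. -/
def Pp.toProb {d : ℕ} {p : ℝ} (μ : Pp d p) : ProbabilityMeasure (EuclideanSpace ℝ (Fin d)) :=
  μ.1

/-- The underlying measure of an element of `𝒫_p`. -/
noncomputable def Pp.toMeasure {d : ℕ} {p : ℝ} (μ : Pp d p) :
    Measure (EuclideanSpace ℝ (Fin d)) :=
  (μ.toProb : Measure (EuclideanSpace ℝ (Fin d)))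

/-- `Π(μ, ν)`: the couplings of `μ` and `ν`, i.e. the measures on the product space whose
marginals are `μ` and `ν`. -/
def couplings {d : ℕ} (μ ν : Measure (EuclideanSpace ℝ (Fin d))) :
    Set (Measure (EuclideanSpace ℝ (Fin d) × EuclideanSpace ℝ (Fin d))) :=
  {π | π.map Prod.fst = μ ∧ π.map Prod.snd = ν}

/-- The `p`-Wasserstein distance
`W_p(μ, ν) = (inf_{π ∈ Π(μ, ν)} ∫ |x - y|^p dπ(x, y))^{1/p}`, with values in `[0, ∞]`. -/
noncomputable def wasserstein {d : ℕ} (p : ℝ) (μ ν : Measure (EuclideanSpace ℝ (Fin d))) :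
    ℝ≥0∞ :=
  (⨅ π ∈ couplings μ ν, ∫⁻ z, ‖z.1 - z.2‖ₑ ^ p ∂π) ^ (1 / p)

/-- The isotropic Gaussian measure `N_σ = N(0, σ² I)` on `ℝ^d`. -/
noncomputable def gauss (d : ℕ) (σ : ℝ) : Measure (EuclideanSpace ℝ (Fin d)) :=
  multivariateGaussian 0 (σ ^ 2 • (1 : Matrix (Fin d) (Fin d) ℝ))

/-- The `σ`-smooth `p`-Wasserstein distance `W_p^{(σ)}(μ, ν) = W_p(μ * N_σ, ν * N_σ)`. -/
noncomputable def smoothWasserstein {d : ℕ} (p σ : ℝ)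
    (μ ν : Measure (EuclideanSpace ℝ (Fin d))) : ℝ≥0∞ :=
  wasserstein p (μ.conv (gauss d σ)) (ν.conv (gauss d σ))

/-- The topology on `𝒫_p` of weak convergence together with convergence of `p`-th moments: the
coarsest topology for which both the inclusion into the space of probability measures with the
weak topology and the `p`-th moment are continuous. -/
noncomputable abbrev weakMomentTopology (d : ℕ) (p : ℝ) : TopologicalSpace (Pp d p) :=
  TopologicalSpace.induced (fun μ : Pp d p => μ.toProb) inferInstance ⊓
    TopologicalSpace.induced (fun μ : Pp d p => moment p μ.toMeasure) inferInstance

end SmoothWasserstein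

/-!
Both metrics are instances of one construction. For a probability measure `γ` with finite `p`-th
moment and nowhere vanishing characteristic function, `W_p(μ * γ, ν * γ)` is a metric on `𝒫_p`
whose topology is that of weak convergence with convergence of `p`-th moments
(`exists_metricSpace_conv`). The Dirac mass at `0` gives `W_p`, the Gaussian gives `W_p^{(σ)}`.

The triangle inequality is the gluing of couplings by disintegration (`exists_gluing`). The rest of
the metric axioms and one half of the topological statement come from the estimate
`|φ_μ(t) - φ_ν(t)| ≤ |t| W_p(μ, ν)` for characteristic functions (`enorm_charFun_sub_le`): dividing
by the characteristic function of `γ`, a vanishing distance forces `μ = ν`, and convergence of the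
smoothed measures forces weak convergence of the original ones by Lévy's theorem. It also makes the
moments of the smoothed measures converge. To descend to the moments of the original measures, note
that `|x|^p` is dominated by a continuous function whose integrals are affine in the smoothed
moments, and that along weakly converging measures integrals of dominated continuous functions
converge (`tendsto_lintegral_of_le`).

Conversely, convolution contracts `W_p` (`wasserstein_conv_le`), so it suffices that weak
convergence with convergence of moments implies `W_p` convergence (`tendsto_wasserstein`). A finite
continuous partition of unity moves each measure, at a small cost that is uniform along the
convergence, to a measure on a fixed finite set of points. The weights on these points
are integrals of bounded continuous functions, so they converge, and two measures on a finite set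
with close weights are close in `W_p` because their common mass need not move.
-/

namespace SmoothWasserstein

open scoped NNReal

variable {d : ℕ} {p : ℝ}

/-! ### Couplings and the metric axioms -/

theorem wasserstein_eq_iInf (hp : 1 ≤ p) (μ ν : Measure (EuclideanSpace ℝ (Fin d))) :
    wasserstein p μ ν = ⨅ π ∈ couplings μ ν, (∫⁻ z, ‖z.1 - z.2‖ₑ ^ p ∂π) ^ (1 / p) := by
  have h : (0 : ℝ) < 1 / p := by positivity
  have := fun x : ℝ≥0∞ => ENNReal.orderIsoRpow_apply (1 / p) h x
  simp_rw [wasserstein, ← this, OrderIso.map_iInf]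

theorem wasserstein_le (hp : 1 ≤ p) {μ ν : Measure (EuclideanSpace ℝ (Fin d))}
    {π : Measure (EuclideanSpace ℝ (Fin d) × EuclideanSpace ℝ (Fin d))} (hπ : π ∈ couplings μ ν) :
    wasserstein p μ ν ≤ (∫⁻ z, ‖z.1 - z.2‖ₑ ^ p ∂π) ^ (1 / p) :=
  (wasserstein_eq_iInf hp μ ν).trans_le (iInf₂_le π hπ)

theorem le_wasserstein (hp : 1 ≤ p) {μ ν : Measure (EuclideanSpace ℝ (Fin d))} {c : ℝ≥0∞}
    (h : ∀ π ∈ couplings μ ν, c ≤ (∫⁻ z, ‖z.1 - z.2‖ₑ ^ p ∂π) ^ (1 / p)) :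
    c ≤ wasserstein p μ ν :=
  (le_iInf₂ h).trans_eq (wasserstein_eq_iInf hp μ ν).symm

theorem isProbabilityMeasure_of_mem_couplings {μ ν : Measure (EuclideanSpace ℝ (Fin d))}
    [IsProbabilityMeasure μ]
    {π : Measure (EuclideanSpace ℝ (Fin d) × EuclideanSpace ℝ (Fin d))} (hπ : π ∈ couplings μ ν) :
    IsProbabilityMeasure π := by
  have : IsProbabilityMeasure (π.map Prod.fst) := hπ.1 ▸ ‹_›
  exact Measure.isProbabilityMeasure_of_map Prod.fst

theorem map_swap_mem_couplings {μ ν : Measure (EuclideanSpace ℝ (Fin d))}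
    {π : Measure (EuclideanSpace ℝ (Fin d) × EuclideanSpace ℝ (Fin d))} (hπ : π ∈ couplings μ ν) :
    π.map Prod.swap ∈ couplings ν μ := by
  constructor
  · rw [Measure.map_map measurable_fst measurable_swap]; exact hπ.2
  · rw [Measure.map_map measurable_snd measurable_swap]; exact hπ.1

theorem lintegral_map_swap_cost
    (π : Measure (EuclideanSpace ℝ (Fin d) × EuclideanSpace ℝ (Fin d))) :
    ∫⁻ z, ‖z.1 - z.2‖ₑ ^ p ∂(π.map Prod.swap) = ∫⁻ z, ‖z.1 - z.2‖ₑ ^ p ∂π := by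
  rw [lintegral_map (by fun_prop) measurable_swap]
  simp [← edist_eq_enorm_sub, edist_comm]

theorem wasserstein_comm (hp : 1 ≤ p) (μ ν : Measure (EuclideanSpace ℝ (Fin d))) :
    wasserstein p μ ν = wasserstein p ν μ := by
  have key (μ ν : Measure (EuclideanSpace ℝ (Fin d))) :
      wasserstein p μ ν ≤ wasserstein p ν μ := le_wasserstein hp fun π hπ => by
    rw [← lintegral_map_swap_cost]
    exact wasserstein_le hp (map_swap_mem_couplings hπ)
  exact (key μ ν).antisymm (key ν μ)

theorem wasserstein_self (hp : 1 ≤ p) (μ : Measure (EuclideanSpace ℝ (Fin d))) :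
    wasserstein p μ μ = 0 := by
  have hm : Measurable fun x : EuclideanSpace ℝ (Fin d) => (x, x) := by fun_prop
  have hp0 : 0 < p := by linarith
  refine le_antisymm ((wasserstein_le hp (π := μ.map fun x => (x, x)) ⟨?_, ?_⟩).trans_eq ?_) zero_le
  · rw [Measure.map_map measurable_fst hm]; exact Measure.map_id
  · rw [Measure.map_map measurable_snd hm]; exact Measure.map_id
  · rw [lintegral_map (by fun_prop) hm]
    simp [hp0]

/-- Gluing of couplings: two couplings with a common marginal `ν` are the `(x, y)` and `(y, z)`
marginals of one measure. It is the conditionally independent product over `ν`. -/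
theorem exists_gluing {μ ν ρ : Measure (EuclideanSpace ℝ (Fin d))} [IsFiniteMeasure ν]
    {π₁ π₂ : Measure (EuclideanSpace ℝ (Fin d) × EuclideanSpace ℝ (Fin d))}
    (h₁ : π₁ ∈ couplings μ ν) (h₂ : π₂ ∈ couplings ν ρ) :
    ∃ θ : Measure (EuclideanSpace ℝ (Fin d) × EuclideanSpace ℝ (Fin d) ×
        EuclideanSpace ℝ (Fin d)),
      θ.map (fun w => (w.1, w.2.1)) = π₁ ∧ θ.map (fun w => w.2) = π₂ := by
  have h₁' := map_swap_mem_couplings h₁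
  have f₂ : IsFiniteMeasure π₂ := by
    have : IsFiniteMeasure (π₂.map Prod.fst) := h₂.1 ▸ ‹_›
    exact Measure.isFiniteMeasure_of_map measurable_fst.aemeasurable
  have f₁ : IsFiniteMeasure (π₁.map Prod.swap) := by
    have : IsFiniteMeasure ((π₁.map Prod.swap).map Prod.fst) := h₁'.1 ▸ ‹_›
    exact Measure.isFiniteMeasure_of_map measurable_fst.aemeasurable
  set κ₁ := (π₁.map Prod.swap).condKernel
  set κ₂ := π₂.condKernel
  have e₁ : ν ⊗ₘ κ₁ = π₁.map Prod.swap := by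
    conv_rhs => rw [← Measure.disintegrate (π₁.map Prod.swap) κ₁]
    rw [Measure.fst, h₁'.1]
  have e₂ : ν ⊗ₘ κ₂ = π₂ := by
    conv_rhs => rw [← Measure.disintegrate π₂ κ₂]
    rw [Measure.fst, h₂.1]
  have hm : Measurable fun w : EuclideanSpace ℝ (Fin d) × EuclideanSpace ℝ (Fin d) ×
      EuclideanSpace ℝ (Fin d) => (w.2.1, w.1, w.2.2) := by fun_prop
  refine ⟨(ν ⊗ₘ (κ₁ ×ₖ κ₂)).map fun w => (w.2.1, w.1, w.2.2), ?_, ?_⟩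
  · have : π₁ = (ν ⊗ₘ κ₁).map Prod.swap := by
      rw [e₁, Measure.map_map measurable_swap measurable_swap]; simp
    rw [this]
    rw [Measure.map_map (by fun_prop) hm]
    refine Measure.ext_of_lintegral _ fun f hf => ?_
    rw [lintegral_map hf (by fun_prop), lintegral_map hf (by fun_prop),
      Measure.lintegral_compProd (by fun_prop), Measure.lintegral_compProd (by fun_prop)]
    refine lintegral_congr fun y => ?_
    rw [Kernel.lintegral_prod _ _ _ (by fun_prop)]
    simp
  · rw [← e₂]
    rw [Measure.map_map (by fun_prop) hm]
    refine Measure.ext_of_lintegral _ fun f hf => ?_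
    rw [lintegral_map hf (by fun_prop),
      Measure.lintegral_compProd (by fun_prop), Measure.lintegral_compProd (by fun_prop)]
    refine lintegral_congr fun y => ?_
    rw [Kernel.lintegral_prod _ _ _ (by fun_prop)]
    simp

theorem wasserstein_triangle (hp : 1 ≤ p) (μ ν ρ : Measure (EuclideanSpace ℝ (Fin d)))
    [IsFiniteMeasure ν] :
    wasserstein p μ ρ ≤ wasserstein p μ ν + wasserstein p ν ρ := by
  rw [wasserstein_eq_iInf hp μ ν, wasserstein_eq_iInf hp ν ρ]
  refine ENNReal.le_iInf₂_add_iInf₂ fun π₁ h₁ π₂ h₂ => ?_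
  obtain ⟨θ, rfl, rfl⟩ := exists_gluing h₁ h₂
  have h : θ.map (fun w => (w.1, w.2.2)) ∈ couplings μ ρ := by
    constructor
    · rw [← h₁.1, Measure.map_map (by fun_prop) (by fun_prop),
        Measure.map_map (by fun_prop) (by fun_prop)]; rfl
    · rw [← h₂.2, Measure.map_map (by fun_prop) (by fun_prop),
        Measure.map_map (by fun_prop) (by fun_prop)]; rfl
  refine (wasserstein_le hp h).trans ?_
  rw [lintegral_map (by fun_prop) (by fun_prop), lintegral_map (by fun_prop) (by fun_prop),
    lintegral_map (by fun_prop) (by fun_prop)]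
  refine le_trans ?_ (ENNReal.lintegral_Lp_add_le (μ := θ) (f := fun w => ‖w.1 - w.2.1‖ₑ)
    (g := fun w => ‖w.2.1 - w.2.2‖ₑ) (by fun_prop) (by fun_prop) hp)
  gcongr with w
  simpa [edist_eq_enorm_sub] using edist_triangle w.1 w.2.1 w.2.2

/-- The `L^p` seminorm `(∫ |x|^p dμ)^{1/p}` is `1`-Lipschitz for `W_p`. -/
theorem moment_rpow_le (hp : 1 ≤ p) (μ ν : Measure (EuclideanSpace ℝ (Fin d))) :
    moment p μ ^ (1 / p) ≤ wasserstein p μ ν + moment p ν ^ (1 / p) := by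
  rw [wasserstein_eq_iInf hp, ENNReal.iInf_add]
  refine le_iInf fun π => ?_
  rw [ENNReal.iInf_add]
  refine le_iInf fun hπ => ?_
  rw [moment, moment, ← hπ.1, ← hπ.2, lintegral_map (by fun_prop) (by fun_prop),
    lintegral_map (by fun_prop) (by fun_prop)]
  refine le_trans ?_ (ENNReal.lintegral_Lp_add_le (μ := π) (f := fun w => ‖w.1 - w.2‖ₑ)
    (g := fun w => ‖w.2‖ₑ) (by fun_prop) (by fun_prop) hp)
  gcongr with w
  simpa using enorm_add_le (w.1 - w.2) w.2

theorem enorm_sub_rpow_le (hp : 1 ≤ p) (x y : EuclideanSpace ℝ (Fin d)) :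
    ‖x - y‖ₑ ^ p ≤ 2 ^ (p - 1) * (‖x‖ₑ ^ p + ‖y‖ₑ ^ p) := by
  refine le_trans ?_ (ENNReal.rpow_add_le_mul_rpow_add_rpow _ _ hp)
  gcongr
  exact enorm_sub_le

theorem two_rpow_ne_top (p : ℝ) : (2 : ℝ≥0∞) ^ (p - 1) ≠ ∞ :=
  ENNReal.rpow_ne_top_of_ne_zero (by simp) (by simp)

theorem wasserstein_ne_top (hp : 1 ≤ p) {μ ν : Measure (EuclideanSpace ℝ (Fin d))}
    [IsProbabilityMeasure μ] [IsProbabilityMeasure ν] (hμ : moment p μ ≠ ∞)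
    (hν : moment p ν ≠ ∞) : wasserstein p μ ν ≠ ∞ := by
  have hp0 : 0 < p := by linarith
  have h : μ.prod ν ∈ couplings μ ν := ⟨by simp, by simp⟩
  refine ne_top_of_le_ne_top ?_ (wasserstein_le hp h)
  refine ENNReal.rpow_ne_top_of_nonneg (by positivity) ?_
  refine ne_top_of_le_ne_top ?_ (lintegral_mono fun z => enorm_sub_rpow_le hp z.1 z.2)
  rw [lintegral_const_mul _ (by fun_prop), lintegral_add_left (by fun_prop)]
  have e₁ : ∫⁻ z, ‖z.1‖ₑ ^ p ∂(μ.prod ν) = moment p μ := by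
    rw [moment, ← h.1, lintegral_map (by fun_prop) (by fun_prop), h.1]
  have e₂ : ∫⁻ z, ‖z.2‖ₑ ^ p ∂(μ.prod ν) = moment p ν := by
    rw [moment, ← h.2, lintegral_map (by fun_prop) (by fun_prop), h.2]
  rw [e₁, e₂]
  exact ENNReal.mul_ne_top (two_rpow_ne_top p) (ENNReal.add_ne_top.2 ⟨hμ, hν⟩)

theorem enorm_exp_sub_exp_le (t x y : EuclideanSpace ℝ (Fin d)) :
    ‖Complex.exp (inner ℝ x t * Complex.I) - Complex.exp (inner ℝ y t * Complex.I)‖ₑ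
      ≤ ‖t‖ₑ * ‖x - y‖ₑ := by
  have h : Complex.exp (inner ℝ x t * Complex.I) - Complex.exp (inner ℝ y t * Complex.I)
      = Complex.exp (inner ℝ y t * Complex.I) *
        (Complex.exp (Complex.I * ((inner ℝ (x - y) t : ℝ) : ℂ)) - 1) := by
    rw [mul_sub, ← Complex.exp_add, inner_sub_left]
    push_cast
    ring_nf
  rw [h, enorm_mul, ← ofReal_norm, Complex.norm_exp_ofReal_mul_I, ENNReal.ofReal_one, one_mul]
  calc _ ≤ ‖(inner ℝ (x - y) t : ℝ)‖ₑ := by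
        rw [← ofReal_norm, ← ofReal_norm]
        exact ENNReal.ofReal_le_ofReal Real.norm_exp_I_mul_ofReal_sub_one_le
    _ ≤ ‖t‖ₑ * ‖x - y‖ₑ := by
        rw [← ofReal_norm, ← ofReal_norm, ← ofReal_norm, ← ENNReal.ofReal_mul (norm_nonneg _),
          mul_comm ‖t‖]
        exact ENNReal.ofReal_le_ofReal (norm_inner_le_norm _ _)

/-- Characteristic functions are Lipschitz for `W_p` at each frequency, because
`x ↦ e^{i⟨x, t⟩}` is `|t|`-Lipschitz and the `L¹` cost is at most the `L^p` cost. -/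
theorem enorm_charFun_sub_le (hp : 1 ≤ p) (μ ν : Measure (EuclideanSpace ℝ (Fin d)))
    [IsProbabilityMeasure μ] [IsProbabilityMeasure ν] (t : EuclideanSpace ℝ (Fin d)) :
    ‖charFun μ t - charFun ν t‖ₑ ≤ ‖t‖ₑ * wasserstein p μ ν := by
  rcases eq_or_ne t 0 with rfl | ht
  · simp
  rw [← ENNReal.div_le_iff' (by simpa using ht) enorm_ne_top]
  refine le_wasserstein hp fun π hπ => ?_
  rw [ENNReal.div_le_iff' (by simpa using ht) enorm_ne_top]
  have := isProbabilityMeasure_of_mem_couplings hπ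
  have hint (f : EuclideanSpace ℝ (Fin d) × EuclideanSpace ℝ (Fin d) → ℝ) (hf : Measurable f) :
      Integrable (fun z => Complex.exp (f z * Complex.I)) π := by
    refine Integrable.of_bound (C := 1) (by fun_prop) (ae_of_all _ fun z => ?_)
    rw [Complex.norm_exp_ofReal_mul_I]
  rw [charFun_apply, charFun_apply, ← hπ.1, ← hπ.2,
    integral_map (by fun_prop) (by fun_prop), integral_map (by fun_prop) (by fun_prop),
    ← integral_sub (hint _ (by fun_prop)) (hint _ (by fun_prop))]
  refine (enorm_integral_le_lintegral_enorm _).trans ?_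
  calc _ ≤ ∫⁻ z, ‖t‖ₑ * ‖z.1 - z.2‖ₑ ∂π := lintegral_mono fun z => enorm_exp_sub_exp_le t z.1 z.2
    _ = ‖t‖ₑ * ∫⁻ z, ‖z.1 - z.2‖ₑ ∂π := lintegral_const_mul _ (by fun_prop)
    _ ≤ _ := by
        gcongr
        simpa [eLpNorm'] using eLpNorm'_le_eLpNorm'_of_exponent_le (f := fun z :
          EuclideanSpace ℝ (Fin d) × EuclideanSpace ℝ (Fin d) => z.1 - z.2) one_pos hp π
          (by fun_prop)

theorem conv_mem_couplings {μ ν γ : Measure (EuclideanSpace ℝ (Fin d))} [IsProbabilityMeasure γ]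
    [SFinite μ] [SFinite ν]
    {π : Measure (EuclideanSpace ℝ (Fin d) × EuclideanSpace ℝ (Fin d))} [SFinite π]
    (hπ : π ∈ couplings μ ν) :
    (π.prod γ).map (fun w => (w.1.1 + w.2, w.1.2 + w.2)) ∈ couplings (μ.conv γ) (ν.conv γ) := by
  constructor
  · rw [Measure.map_map (by fun_prop) (by fun_prop)]
    refine Measure.ext_of_lintegral _ fun f hf => ?_
    rw [lintegral_map hf (by fun_prop), lintegral_prod _ (by fun_prop), Measure.lintegral_conv hf,
      ← hπ.1, lintegral_map _ (by fun_prop)]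
    · rfl
    · exact Measurable.lintegral_prod_right' (f := fun z => f (z.1 + z.2)) (by fun_prop)
  · rw [Measure.map_map (by fun_prop) (by fun_prop)]
    refine Measure.ext_of_lintegral _ fun f hf => ?_
    rw [lintegral_map hf (by fun_prop), lintegral_prod _ (by fun_prop), Measure.lintegral_conv hf,
      ← hπ.2, lintegral_map _ (by fun_prop)]
    · rfl
    · exact Measurable.lintegral_prod_right' (f := fun z => f (z.1 + z.2)) (by fun_prop)

/-- Convolution with a probability measure contracts `W_p`: add the same independent noise to both
components of a coupling. -/
theorem wasserstein_conv_le (hp : 1 ≤ p) (μ ν γ : Measure (EuclideanSpace ℝ (Fin d)))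
    [IsProbabilityMeasure μ] [SFinite ν] [IsProbabilityMeasure γ] :
    wasserstein p (μ.conv γ) (ν.conv γ) ≤ wasserstein p μ ν := by
  refine le_wasserstein hp fun π hπ => ?_
  have := isProbabilityMeasure_of_mem_couplings hπ
  refine (wasserstein_le hp (conv_mem_couplings hπ)).trans_eq ?_
  rw [lintegral_map (by fun_prop) (by fun_prop), lintegral_prod _ (by fun_prop)]
  simp

theorem moment_conv_le (hp : 1 ≤ p) (μ γ : Measure (EuclideanSpace ℝ (Fin d)))
    [IsProbabilityMeasure μ] [IsProbabilityMeasure γ] :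
    moment p (μ.conv γ) ≤ 2 ^ (p - 1) * (moment p μ + moment p γ) := by
  rw [moment, Measure.lintegral_conv (by fun_prop)]
  calc ∫⁻ x, ∫⁻ y, ‖x + y‖ₑ ^ p ∂γ ∂μ
      ≤ ∫⁻ x, ∫⁻ y, 2 ^ (p - 1) * (‖x‖ₑ ^ p + ‖y‖ₑ ^ p) ∂γ ∂μ := by
        gcongr with x y
        simpa using enorm_sub_rpow_le hp x (-y)
    _ = 2 ^ (p - 1) * (moment p μ + moment p γ) := by
        simp_rw [lintegral_const_mul' _ _ (two_rpow_ne_top p)]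
        congr 1
        simp_rw [lintegral_add_left measurable_const]
        rw [lintegral_add_right _ measurable_const]
        simp [moment]

/-! ### Integrals along weakly converging measures -/

section WeakConvergence

variable {X : Type*} [MeasurableSpace X] [TopologicalSpace X] [OpensMeasurableSpace X]
  {ι : Type*} {l : Filter ι} {μs : ι → ProbabilityMeasure X} {μ : ProbabilityMeasure X}

/-- The integral of a nonnegative continuous function, bounded or not, is lower semicontinuous for
weak convergence: it is the supremum of the integrals of the truncations `min f n`. -/
theorem eventually_lt_lintegral (h : Tendsto μs l (𝓝 μ)) {f : X → ℝ≥0} (hf : Continuous f)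
    {c : ℝ≥0∞} (hc : c < ∫⁻ x, f x ∂(μ : Measure X)) :
    ∀ᶠ i in l, c < ∫⁻ x, f x ∂(μs i : Measure X) := by
  have hsup : ∫⁻ x, f x ∂(μ : Measure X)
      = ⨆ n : ℕ, ∫⁻ x, ((min (f x) n : ℝ≥0) : ℝ≥0∞) ∂(μ : Measure X) := by
    rw [← lintegral_iSup]
    · refine lintegral_congr fun x => le_antisymm ?_ ?_
      · obtain ⟨n, hn⟩ := exists_nat_ge (f x)
        exact le_iSup_of_le n (by simp [hn])
      · exact iSup_le fun n => by simp
    · intro n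
      have : Continuous fun x => min (f x) (n : ℝ≥0) := by fun_prop
      exact this.measurable.coe_nnreal_ennreal
    · intro m n hmn x
      simp only [ENNReal.coe_le_coe]
      gcongr
  rw [hsup, lt_iSup_iff] at hc
  obtain ⟨n, hn⟩ := hc
  let g : BoundedContinuousFunction X ℝ≥0 :=
    BoundedContinuousFunction.mkOfBound ⟨fun x => min (f x) n, by fun_prop⟩ n fun x y => by
      rw [NNReal.dist_eq, abs_le]
      have h₁ : ((min (f x) n : ℝ≥0) : ℝ) ≤ n := by exact_mod_cast min_le_right (f x) (n : ℝ≥0)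
      have h₂ : ((min (f y) n : ℝ≥0) : ℝ) ≤ n := by exact_mod_cast min_le_right (f y) (n : ℝ≥0)
      have h₃ := (min (f x) (n : ℝ≥0)).coe_nonneg
      have h₄ := (min (f y) (n : ℝ≥0)).coe_nonneg
      constructor <;> simp only [ContinuousMap.coe_mk] <;> linarith
  filter_upwards [(ProbabilityMeasure.tendsto_iff_forall_lintegral_tendsto.1 h g).eventually_const_lt
    hn] with i hi
  refine hi.trans_le (lintegral_mono fun x => ?_)
  exact ENNReal.coe_le_coe.2 (min_le_left _ _)

/-- Dominated convergence along weakly converging measures. Both `∫ f` and `∫ (k - f)` are lower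
semicontinuous and their sum `∫ k` converges, so each of them converges. -/
theorem tendsto_lintegral_of_le (h : Tendsto μs l (𝓝 μ)) {f k : X → ℝ≥0} (hf : Continuous f)
    (hk : Continuous k) (hfk : ∀ x, f x ≤ k x) (hfin : ∫⁻ x, k x ∂(μ : Measure X) ≠ ∞)
    (hlim : Tendsto (fun i => ∫⁻ x, k x ∂(μs i : Measure X)) l
      (𝓝 (∫⁻ x, k x ∂(μ : Measure X)))) :
    Tendsto (fun i => ∫⁻ x, f x ∂(μs i : Measure X)) l (𝓝 (∫⁻ x, f x ∂(μ : Measure X))) := by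
  have hsum (ν : Measure X) :
      ∫⁻ x, f x ∂ν + ∫⁻ x, ((k x - f x : ℝ≥0) : ℝ≥0∞) ∂ν = ∫⁻ x, k x ∂ν := by
    rw [← lintegral_add_left hf.measurable.coe_nnreal_ennreal]
    refine lintegral_congr fun x => ?_
    rw [← ENNReal.coe_add, add_tsub_cancel_of_le (hfk x)]
  have hg : Continuous fun x => k x - f x := by fun_prop
  have hF : ∫⁻ x, f x ∂(μ : Measure X) ≠ ∞ :=
    ne_top_of_le_ne_top hfin (lintegral_mono fun x => ENNReal.coe_le_coe.2 (hfk x))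
  have hH : ∫⁻ x, ((k x - f x : ℝ≥0) : ℝ≥0∞) ∂(μ : Measure X) ≠ ∞ :=
    ne_top_of_le_ne_top hfin (lintegral_mono fun x => ENNReal.coe_le_coe.2 tsub_le_self)
  refine tendsto_order.2 ⟨fun c hc => eventually_lt_lintegral h hf hc, fun c hc => ?_⟩
  -- When `H = ∫ (k - f) dμ` vanishes, no `H - δ < H` is available, but then `∫ f` is bounded
  -- above by `∫ k`, which tends to `∫ f dμ`.
  rcases eq_or_ne (∫⁻ x, ((k x - f x : ℝ≥0) : ℝ≥0∞) ∂(μ : Measure X)) 0 with h0 | h0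
  · have e := hsum μ
    rw [h0, add_zero] at e
    rw [e] at hc
    filter_upwards [hlim.eventually_lt_const hc] with i hi
    exact (lintegral_mono fun x => ENNReal.coe_le_coe.2 (hfk x)).trans_lt hi
  · obtain ⟨b, hFb, hbc⟩ := exists_between hc
    set H := ∫⁻ x, ((k x - f x : ℝ≥0) : ℝ≥0∞) ∂(μ : Measure X)
    set F := ∫⁻ x, f x ∂(μ : Measure X)
    obtain ⟨δ, hδ, hδb⟩ : ∃ δ : ℝ≥0∞, 0 < δ ∧ F + δ < c :=
      ⟨b - F, tsub_pos_of_lt hFb, by rwa [add_tsub_cancel_of_le hFb.le]⟩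
    have hδ2 : δ / 2 ≠ 0 := (ENNReal.half_pos hδ.ne').ne'
    have hδtop : δ / 2 ≠ ∞ := by
      refine (ENNReal.div_lt_top ?_ (by simp)).ne
      rintro rfl
      simp at hδb
    have hK := hsum μ
    have hKlt : ∫⁻ x, k x ∂(μ : Measure X) < ∫⁻ x, k x ∂(μ : Measure X) + δ / 2 :=
      ENNReal.lt_add_right hfin hδ2
    have hHlt : H - δ / 2 < H := ENNReal.sub_lt_self hH h0 hδ2
    filter_upwards [hlim.eventually_lt_const hKlt, eventually_lt_lintegral h hg hHlt] with i h₁ h₂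
    refine lt_of_le_of_lt ?_ hδb
    rw [← hsum (μs i)] at h₁
    rw [← hK] at h₁
    have h₃ : H ≤ ∫⁻ x, ((k x - f x : ℝ≥0) : ℝ≥0∞) ∂(μs i : Measure X) + δ / 2 :=
      tsub_le_iff_right.1 h₂.le
    set Hi := ∫⁻ x, ((k x - f x : ℝ≥0) : ℝ≥0∞) ∂(μs i : Measure X)
    have hHi : Hi ≠ ∞ := fun h => by simp [h] at h₁
    refine (ENNReal.add_le_add_iff_right hHi).1 (h₁.le.trans ?_)
    calc F + H + δ / 2 ≤ F + (Hi + δ / 2) + δ / 2 := by gcongr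
      _ = F + (δ / 2 + δ / 2) + Hi := by ring
      _ = F + δ + Hi := by rw [ENNReal.add_halves]

end WeakConvergence

/-- Convergence of `p`-th moments can be read off after convolution with `γ`: `|x|^p` is dominated
by the continuous function `2^{p-1} (∫ |x + z|^p dγ(z) + ∫ |z|^p dγ(z))`. -/
theorem tendsto_moment_of_conv (hp : 1 ≤ p) {γ : Measure (EuclideanSpace ℝ (Fin d))}
    [IsProbabilityMeasure γ] (hγ : moment p γ ≠ ∞) {ι : Type*} {l : Filter ι}
    {μs : ι → ProbabilityMeasure (EuclideanSpace ℝ (Fin d))}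
    {μ : ProbabilityMeasure (EuclideanSpace ℝ (Fin d))} (h : Tendsto μs l (𝓝 μ))
    (hfin : moment p ((μ : Measure (EuclideanSpace ℝ (Fin d))).conv γ) ≠ ∞)
    (hlim : Tendsto (fun i => moment p ((μs i : Measure (EuclideanSpace ℝ (Fin d))).conv γ)) l
      (𝓝 (moment p ((μ : Measure (EuclideanSpace ℝ (Fin d))).conv γ)))) :
    Tendsto (fun i => moment p (μs i : Measure (EuclideanSpace ℝ (Fin d)))) l
      (𝓝 (moment p (μ : Measure (EuclideanSpace ℝ (Fin d))))) := by
  have hp0 : 0 < p := by linarith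
  have hC := two_rpow_ne_top p
  set g : EuclideanSpace ℝ (Fin d) → ℝ≥0∞ := fun x => ∫⁻ z, ‖x + z‖ₑ ^ p ∂γ with hg
  have hbound (C : ℝ≥0∞) (hC' : C ≠ ∞) :
      ∫⁻ z, 2 ^ (p - 1) * (C + ‖z‖ₑ ^ p) ∂γ ≠ ∞ := by
    rw [lintegral_const_mul' _ _ hC, lintegral_add_left measurable_const]
    refine ENNReal.mul_ne_top hC (ENNReal.add_ne_top.2 ⟨?_, hγ⟩)
    simpa using hC'
  have hadd (x z : EuclideanSpace ℝ (Fin d)) :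
      ‖x + z‖ₑ ^ p ≤ 2 ^ (p - 1) * (‖x‖ₑ ^ p + ‖z‖ₑ ^ p) := by
    simpa using enorm_sub_rpow_le hp x (-z)
  have hgfin (x) : g x ≠ ∞ := ne_top_of_le_ne_top
    (hbound (‖x‖ₑ ^ p) (ENNReal.rpow_ne_top_of_nonneg hp0.le enorm_ne_top))
    (lintegral_mono fun z => hadd x z)
  have hgcont : Continuous g := by
    refine continuous_iff_continuousAt.2 fun x₀ => ?_
    refine tendsto_lintegral_filter_of_dominated_convergence
      (fun z => 2 ^ (p - 1) * ((‖x₀‖ₑ + 1) ^ p + ‖z‖ₑ ^ p)) ?_ ?_ ?_ ?_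
    · exact Eventually.of_forall fun x => by fun_prop
    · have : ∀ᶠ x in 𝓝 x₀, ‖x‖ₑ < ‖x₀‖ₑ + 1 :=
        (continuous_enorm.tendsto x₀).eventually_lt_const
          (ENNReal.lt_add_right enorm_ne_top one_ne_zero)
      filter_upwards [this] with x hx
      refine ae_of_all _ fun z => (hadd x z).trans ?_
      gcongr
    · exact hbound _ (ENNReal.rpow_ne_top_of_nonneg hp0.le (by simp))
    · refine ae_of_all _ fun z => ?_
      refine Tendsto.ennrpow_const p ?_
      exact (continuous_enorm.comp (continuous_add_const z)).tendsto x₀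
  have hkfin (x) : 2 ^ (p - 1) * (g x + moment p γ) ≠ ∞ :=
    ENNReal.mul_ne_top hC (ENNReal.add_ne_top.2 ⟨hgfin x, hγ⟩)
  have hkint (ν : Measure (EuclideanSpace ℝ (Fin d))) [IsProbabilityMeasure ν] :
      ∫⁻ x, (2 ^ (p - 1) * (g x + moment p γ)).toNNReal ∂ν
        = 2 ^ (p - 1) * (moment p (ν.conv γ) + moment p γ) := by
    simp_rw [ENNReal.coe_toNNReal (hkfin _)]
    rw [lintegral_const_mul' _ _ hC, lintegral_add_right _ measurable_const, moment.eq_def p (ν.conv γ),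
      Measure.lintegral_conv (by fun_prop)]
    simp [hg]
  have hf (x : EuclideanSpace ℝ (Fin d)) : ‖x‖ₑ ^ p = ((‖x‖₊ ^ p : ℝ≥0) : ℝ≥0∞) := by
    rw [enorm_eq_nnnorm, ENNReal.coe_rpow_of_nonneg _ hp0.le]
  have key := tendsto_lintegral_of_le h (f := fun x => ‖x‖₊ ^ p)
    (k := fun x => (2 ^ (p - 1) * (g x + moment p γ)).toNNReal) ?_ ?_ ?_ ?_ ?_
  · simpa only [moment, hf] using key
  · exact (NNReal.continuous_rpow_const hp0.le).comp continuous_nnnorm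
  · refine continuous_iff_continuousAt.2 fun x => (ENNReal.tendsto_toNNReal (hkfin x)).comp ?_
    exact ENNReal.Tendsto.const_mul ((hgcont.tendsto x).add tendsto_const_nhds) (Or.inr hC)
  · intro x
    rw [← ENNReal.coe_le_coe, ENNReal.coe_toNNReal (hkfin x), ← hf]
    calc ‖x‖ₑ ^ p = ∫⁻ _, ‖x‖ₑ ^ p ∂γ := by simp
      _ ≤ ∫⁻ z, 2 ^ (p - 1) * (‖x + z‖ₑ ^ p + ‖z‖ₑ ^ p) ∂γ := by
          gcongr with z
          simpa using enorm_sub_rpow_le hp (x + z) z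
      _ = _ := by
          rw [lintegral_const_mul' _ _ hC, lintegral_add_left (by fun_prop)]
          rfl
  · rw [hkint]
    exact ENNReal.mul_ne_top hC (ENNReal.add_ne_top.2 ⟨hfin, hγ⟩)
  · simp_rw [hkint]
    exact ENNReal.Tendsto.const_mul (hlim.add tendsto_const_nhds) (Or.inr hC)

/-- The coupling is the product measure normalised by the common mass. For mass `0` the factor is
`∞`, but the product vanishes. -/
theorem couplings_nonempty (α β : Measure (EuclideanSpace ℝ (Fin d)))
    [IsFiniteMeasure α] [IsFiniteMeasure β] (h : α Set.univ = β Set.univ) :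
    (couplings α β).Nonempty := by
  have key (ν : Measure (EuclideanSpace ℝ (Fin d))) [IsFiniteMeasure ν] :
      (ν Set.univ)⁻¹ • ν Set.univ • ν = ν := by
    rcases eq_or_ne (ν Set.univ) 0 with h0 | h0
    · simp [Measure.measure_univ_eq_zero.1 h0]
    · rw [smul_smul, ENNReal.inv_mul_cancel h0 (measure_ne_top _ _), one_smul]
  refine ⟨(α Set.univ)⁻¹ • α.prod β, ?_, ?_⟩
  · rw [Measure.map_smul, Measure.map_fst_prod, ← h, key]
  · rw [Measure.map_smul, Measure.map_snd_prod, h, key]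

/-- Mass common to two measures can stay in place; the rest is transported by any coupling of the
two remainders. -/
theorem wasserstein_add_add_le (hp : 1 ≤ p) (κ α β : Measure (EuclideanSpace ℝ (Fin d)))
    [IsFiniteMeasure α] [IsFiniteMeasure β] (h : α Set.univ = β Set.univ) :
    wasserstein p (κ + α) (κ + β) ≤ (2 ^ (p - 1) * (moment p α + moment p β)) ^ (1 / p) := by
  have hp0 : 0 < p := by linarith
  obtain ⟨θ, hfst, hsnd⟩ := couplings_nonempty α β h
  have hd : Measurable fun x : EuclideanSpace ℝ (Fin d) => (x, x) := by fun_prop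
  have hmem : κ.map (fun x => (x, x)) + θ ∈ couplings (κ + α) (κ + β) := by
    constructor
    · rw [Measure.map_add _ _ measurable_fst, hfst, Measure.map_map measurable_fst hd]
      congr 1
      exact Measure.map_id
    · rw [Measure.map_add _ _ measurable_snd, hsnd, Measure.map_map measurable_snd hd]
      congr 1
      exact Measure.map_id
  refine (wasserstein_le hp hmem).trans ?_
  have hdiag : ∫⁻ z, ‖z.1 - z.2‖ₑ ^ p ∂κ.map (fun x => (x, x)) = 0 := by
    rw [lintegral_map (by fun_prop) hd]
    simp [hp0]
  refine ENNReal.rpow_le_rpow ?_ (by positivity)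
  rw [lintegral_add_measure, hdiag, zero_add]
  calc ∫⁻ z, ‖z.1 - z.2‖ₑ ^ p ∂θ
      ≤ ∫⁻ z, 2 ^ (p - 1) * (‖z.1‖ₑ ^ p + ‖z.2‖ₑ ^ p) ∂θ :=
        lintegral_mono fun z => enorm_sub_rpow_le hp z.1 z.2
    _ = 2 ^ (p - 1) * (moment p α + moment p β) := by
        rw [lintegral_const_mul _ (by fun_prop), lintegral_add_left (by fun_prop), moment, moment,
          ← hfst, ← hsnd, lintegral_map (by fun_prop) measurable_fst,
          lintegral_map (by fun_prop) measurable_snd]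

/-! ### Transport to finitely many points -/

section Discretization

variable {ι : Type*} [Fintype ι]

theorem moment_sum_dirac (m : ι → ℝ≥0∞) (a : ι → EuclideanSpace ℝ (Fin d)) :
    moment p (∑ i, m i • Measure.dirac (a i)) = ∑ i, m i * ‖a i‖ₑ ^ p := by
  simp [moment, lintegral_finsetSum_measure]

theorem wasserstein_sum_dirac_le (hp : 1 ≤ p) (m m' : ι → ℝ≥0∞)
    (a : ι → EuclideanSpace ℝ (Fin d)) (hm : ∑ i, m i = 1) (hm' : ∑ i, m' i = 1) :
    wasserstein p (∑ i, m i • Measure.dirac (a i)) (∑ i, m' i • Measure.dirac (a i)) ≤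
      (2 ^ (p - 1) * ∑ i, ((m i - m' i) + (m' i - m i)) * ‖a i‖ₑ ^ p) ^ (1 / p) := by
  have e : ∑ i, m i • Measure.dirac (a i)
      = ∑ i, min (m i) (m' i) • Measure.dirac (a i) + ∑ i, (m i - m' i) • Measure.dirac (a i) := by
    rw [← Finset.sum_add_distrib]
    simp_rw [← add_smul, add_comm (min _ _), tsub_add_min]
  have e' : ∑ i, m' i • Measure.dirac (a i)
      = ∑ i, min (m i) (m' i) • Measure.dirac (a i) + ∑ i, (m' i - m i) • Measure.dirac (a i) := by
    rw [← Finset.sum_add_distrib]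
    simp_rw [← add_smul, min_comm (m _), add_comm (min _ _), tsub_add_min]
  have hle (i) : m i ≤ 1 := hm ▸ Finset.single_le_sum (fun _ _ => zero_le) (Finset.mem_univ i)
  have hle' (i) : m' i ≤ 1 := hm' ▸ Finset.single_le_sum (fun _ _ => zero_le) (Finset.mem_univ i)
  have hfin (w : ι → ℝ≥0∞) (hw : ∀ i, w i ≤ 1) :
      IsFiniteMeasure (∑ i, w i • Measure.dirac (a i)) := by
    refine ⟨?_⟩
    simp only [Measure.finsetSum_apply, Measure.smul_apply, smul_eq_mul, measure_univ, mul_one]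
    exact ENNReal.sum_lt_top.2 fun i _ => (hw i).trans_lt (by simp)
  have := hfin (fun i => m i - m' i) fun i => tsub_le_self.trans (hle i)
  have := hfin (fun i => m' i - m i) fun i => tsub_le_self.trans (hle' i)
  have := hfin (fun i => min (m i) (m' i)) fun i => (min_le_left _ _).trans (hle i)
  have huniv : (∑ i, (m i - m' i) • Measure.dirac (a i)) Set.univ
      = (∑ i, (m' i - m i) • Measure.dirac (a i)) Set.univ := by
    have h₁ := congrArg (fun ν => ν Set.univ) e
    have h₂ := congrArg (fun ν => ν Set.univ) e'
    have h₃ : (∑ i, m i • Measure.dirac (a i)) Set.univ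
      = (∑ i, m' i • Measure.dirac (a i)) Set.univ := by simp [hm, hm']
    simp only [Measure.add_apply] at h₁ h₂
    rw [h₁, h₂] at h₃
    exact (ENNReal.add_right_inj (measure_ne_top _ _)).1 h₃
  rw [e, e']
  refine (wasserstein_add_add_le hp _ _ _ huniv).trans_eq ?_
  simp_rw [moment_sum_dirac, ← Finset.sum_add_distrib, add_mul]

/-- Sending `x` to `a i` with probability `φ i x` moves `μ` to a measure on the points `a i`, at
cost `∑ᵢ ∫ φ i x |x - a i|^p dμ(x)`. -/
theorem wasserstein_discretization_le (hp : 1 ≤ p) (μ : Measure (EuclideanSpace ℝ (Fin d)))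
    {φ : ι → EuclideanSpace ℝ (Fin d) → ℝ≥0} (hφ : ∀ i, Measurable (φ i))
    (hsum : ∀ x, ∑ i, φ i x = 1) (a : ι → EuclideanSpace ℝ (Fin d)) :
    wasserstein p μ (∑ i, (∫⁻ x, φ i x ∂μ) • Measure.dirac (a i)) ≤
      (∫⁻ x, ∑ i, φ i x * ‖x - a i‖ₑ ^ p ∂μ) ^ (1 / p) := by
  have hφ' (i) : Measurable fun x => (φ i x : ℝ≥0∞) := (hφ i).coe_nnreal_ennreal
  have hm (i) : Measurable fun x : EuclideanSpace ℝ (Fin d) => (x, a i) := by fun_prop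
  have hmem : ∑ i, (μ.withDensity fun x => φ i x).map (fun x => (x, a i)) ∈
      couplings μ (∑ i, (∫⁻ x, φ i x ∂μ) • Measure.dirac (a i)) := by
    constructor
    · refine Measure.ext_of_lintegral _ fun f hf => ?_
      rw [lintegral_map hf measurable_fst, lintegral_finsetSum_measure]
      have hmap (i) : ∫⁻ z, f z.1 ∂(μ.withDensity fun x => φ i x).map (fun x => (x, a i))
          = ∫⁻ x, φ i x * f x ∂μ := by
        rw [lintegral_map (f := fun z => f z.1) (by fun_prop) (hm i),
          lintegral_withDensity_eq_lintegral_mul _ (hφ' i) hf]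
        rfl
      simp_rw [hmap]
      rw [← lintegral_finsetSum _ fun i _ => by fun_prop]
      refine lintegral_congr fun x => ?_
      rw [← Finset.sum_mul, ← ENNReal.ofNNReal_finsetSum, hsum, ENNReal.coe_one, one_mul]
    · refine Measure.ext_of_lintegral _ fun f hf => ?_
      rw [lintegral_map hf measurable_snd, lintegral_finsetSum_measure, lintegral_finsetSum_measure]
      refine Finset.sum_congr rfl fun i _ => ?_
      rw [lintegral_map (f := fun z => f z.2) (by fun_prop) (hm i)]
      simp [withDensity_apply, mul_comm]
  refine (wasserstein_le hp hmem).trans_eq ?_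
  congr 1
  rw [lintegral_finsetSum_measure, lintegral_finsetSum _ fun i _ => by fun_prop]
  refine Finset.sum_congr rfl fun i _ => ?_
  rw [lintegral_map (by fun_prop) (hm _),
    lintegral_withDensity_eq_lintegral_mul _ (hφ' _) (by fun_prop)]
  rfl

end Discretization

/-- A finite continuous partition of unity whose members are concentrated within `ε` of points
`a i`, except for one member `ψ` that vanishes on the ball of radius `R` and is sent to `0`. -/
theorem exists_partition (d : ℕ) (hp : 1 ≤ p) {ε : ℝ≥0} (hε : 0 < ε) (R : ℝ) :
    ∃ (ι : Type) (_ : Fintype ι) (φ : ι → EuclideanSpace ℝ (Fin d) → ℝ≥0)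
      (a : ι → EuclideanSpace ℝ (Fin d)) (ψ : EuclideanSpace ℝ (Fin d) → ℝ≥0),
      (∀ i, Continuous (φ i)) ∧ (∀ x, ∑ i, φ i x = 1) ∧ Continuous ψ ∧ (∀ x, ψ x ≤ 1) ∧
      (∀ x, ‖x‖ ≤ R → ψ x = 0) ∧
      ∀ x, ∑ i, (φ i x : ℝ≥0∞) * ‖x - a i‖ₑ ^ p ≤ (ε : ℝ≥0∞) ^ p + ψ x * ‖x‖ₑ ^ p := by
  have hp0 : 0 < p := by linarith
  obtain ⟨t, -, htfin, ht⟩ := Metric.totallyBounded_iff.1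
    (isCompact_closedBall (0 : EuclideanSpace ℝ (Fin d)) R).totallyBounded (ε / 2) (by positivity)
    |>.imp fun t ht => (⟨trivial, ht⟩ : True ∧ _)
  lift t to Finset (EuclideanSpace ℝ (Fin d)) using htfin
  -- tent functions supported in the `ε`-balls, with sum `S ≥ ε / 2` on the ball of radius `R`
  obtain ⟨g, hgdef⟩ : ∃ g : EuclideanSpace ℝ (Fin d) → EuclideanSpace ℝ (Fin d) → ℝ≥0,
    ∀ c x, g c x = ε - nndist x c := ⟨_, fun _ _ => rfl⟩
  obtain ⟨S, hSdef⟩ : ∃ S : EuclideanSpace ℝ (Fin d) → ℝ≥0, ∀ x, S x = ∑ c : t, g c x :=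
    ⟨_, fun _ => rfl⟩
  have hg (c) : Continuous (g c) := by
    rw [funext (hgdef c)]
    fun_prop
  have hS : Continuous S := by
    rw [funext hSdef]
    fun_prop
  have hmax (x) : 0 < max (S x) (ε / 2) := lt_max_of_lt_right (by positivity)
  have hφ (c : EuclideanSpace ℝ (Fin d)) : Continuous fun x => g c x / max (S x) (ε / 2) :=
    (hg c).div (by fun_prop) fun x => (hmax x).ne'
  have hquot : Continuous fun x => S x / max (S x) (ε / 2) :=
    hS.div (by fun_prop) fun x => (hmax x).ne'
  have hle (x) : S x / max (S x) (ε / 2) ≤ 1 := div_le_one_of_le₀ (le_max_left _ _) zero_le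
  have hψ : Continuous fun x => 1 - S x / max (S x) (ε / 2) := by fun_prop
  refine ⟨Option t, inferInstance, fun i x => i.elim (1 - S x / max (S x) (ε / 2))
    fun c => g c x / max (S x) (ε / 2), fun i => i.elim 0 fun c => c,
    fun x => 1 - S x / max (S x) (ε / 2), ?_, ?_, hψ, fun x => tsub_le_self, ?_, ?_⟩
  · rintro (_ | c)
    exacts [hψ, hφ c]
  · intro x
    rw [Fintype.sum_option]
    simp only [Option.elim]
    rw [← Finset.sum_div, ← hSdef]
    exact tsub_add_cancel_of_le (hle x)
  · intro x hx
    obtain ⟨c, hc, hxc⟩ := Set.mem_iUnion₂.1 (ht (mem_closedBall_zero_iff.2 hx))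
    have h₁ : ε / 2 ≤ g c x := by
      rw [hgdef]
      refine le_tsub_of_add_le_left ?_
      rw [← NNReal.coe_le_coe]
      push_cast
      rw [Metric.mem_ball] at hxc
      linarith
    have h₂ : ε / 2 ≤ S x := hSdef x ▸ h₁.trans
      (Finset.single_le_sum (f := fun c : t => g c x) (fun _ _ => zero_le) (Finset.mem_univ ⟨c, hc⟩))
    beta_reduce
    rw [max_eq_left h₂, div_self (ne_of_gt (lt_of_lt_of_le (by positivity) h₂)), tsub_self]
  · intro x
    rw [Fintype.sum_option]
    simp only [Option.elim, sub_zero]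
    rw [add_comm]
    refine add_le_add_left ?_ _
    calc ∑ c : t, ((g c x / max (S x) (ε / 2) : ℝ≥0) : ℝ≥0∞) * ‖x - c‖ₑ ^ p
        ≤ ∑ c : t, ((g c x / max (S x) (ε / 2) : ℝ≥0) : ℝ≥0∞) * (ε : ℝ≥0∞) ^ p := by
          refine Finset.sum_le_sum fun c _ => ?_
          rcases le_total ε (nndist x c) with h | h
          · simp [hgdef, tsub_eq_zero_of_le h]
          · gcongr
            rw [← edist_eq_enorm_sub, edist_nndist]
            exact ENNReal.coe_le_coe.2 h
      _ = ((S x / max (S x) (ε / 2) : ℝ≥0) : ℝ≥0∞) * (ε : ℝ≥0∞) ^ p := by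
          rw [← Finset.sum_mul, ← ENNReal.ofNNReal_finsetSum, ← Finset.sum_div, ← hSdef]
      _ ≤ 1 * (ε : ℝ≥0∞) ^ p := by
          gcongr
          exact_mod_cast hle x
      _ = _ := one_mul _

theorem tendsto_setLIntegral_norm_gt {μ : Measure (EuclideanSpace ℝ (Fin d))}
    (hμ : moment p μ ≠ ∞) :
    Tendsto (fun n : ℕ => ∫⁻ x in {x | (n : ℝ) < ‖x‖}, ‖x‖ₑ ^ p ∂μ) atTop (𝓝 0) := by
  have hs (n : ℕ) : MeasurableSet {x : EuclideanSpace ℝ (Fin d) | (n : ℝ) < ‖x‖} :=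
    measurableSet_lt measurable_const measurable_norm
  have : ∫⁻ _, 0 ∂μ = 0 := lintegral_zero
  simp_rw [← lintegral_indicator (hs _)]
  rw [← this]
  refine tendsto_lintegral_of_dominated_convergence (fun x => ‖x‖ₑ ^ p) ?_ ?_ hμ ?_
  · exact fun n => Measurable.indicator (by fun_prop) (hs n)
  · exact fun n => ae_of_all _ fun x => Set.indicator_le_self _ _ x
  · refine ae_of_all _ fun x => tendsto_const_nhds.congr' ?_
    obtain ⟨n, hn⟩ := exists_nat_ge ‖x‖
    filter_upwards [eventually_ge_atTop n] with m hm
    rw [Set.indicator_of_notMem]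
    simpa using hn.trans (Nat.cast_le.2 hm)

/-! ### The topology of `W_p` -/

/-- Weak convergence together with convergence of `p`-th moments implies `W_p` convergence. -/
theorem tendsto_wasserstein (hp : 1 ≤ p) {ι : Type*} {l : Filter ι}
    {μs : ι → ProbabilityMeasure (EuclideanSpace ℝ (Fin d))}
    {μ : ProbabilityMeasure (EuclideanSpace ℝ (Fin d))} (h : Tendsto μs l (𝓝 μ))
    (hfin : moment p (μ : Measure (EuclideanSpace ℝ (Fin d))) ≠ ∞)
    (hlim : Tendsto (fun i => moment p (μs i : Measure (EuclideanSpace ℝ (Fin d)))) l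
      (𝓝 (moment p (μ : Measure (EuclideanSpace ℝ (Fin d)))))) :
    Tendsto (fun i => wasserstein p (μs i : Measure (EuclideanSpace ℝ (Fin d))) μ) l (𝓝 0) := by
  have hp0 : 0 < p := by linarith
  have hf (x : EuclideanSpace ℝ (Fin d)) : ‖x‖ₑ ^ p = ((‖x‖₊ ^ p : ℝ≥0) : ℝ≥0∞) := by
    rw [enorm_eq_nnnorm, ENNReal.coe_rpow_of_nonneg _ hp0.le]
  have hfc : Continuous fun x : EuclideanSpace ℝ (Fin d) => ‖x‖₊ ^ p :=
    (NNReal.continuous_rpow_const hp0.le).comp continuous_nnnorm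
  refine ENNReal.tendsto_nhds_zero.2 fun η hη => ?_
  obtain ⟨ε, hε, hεη⟩ : ∃ ε : ℝ≥0, 0 < ε ∧ (5 * ε : ℝ≥0∞) < η := by
    obtain ⟨δ, hδ, hδη⟩ := ENNReal.lt_iff_exists_nnreal_btwn.1 hη
    refine ⟨δ / 5, by have := ENNReal.coe_pos.1 hδ; positivity, ?_⟩
    have : 5 * (δ / 5) = δ := mul_div_cancel₀ δ (by norm_num)
    exact_mod_cast this.symm ▸ hδη
  have hεp : 0 < (ε : ℝ≥0∞) ^ p := ENNReal.rpow_pos (by exact_mod_cast hε) (by simp)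
  obtain ⟨n, hn⟩ := ((tendsto_setLIntegral_norm_gt hfin).eventually_lt_const hεp).exists
  obtain ⟨κ, _, φ, a, ψ, hφ, hsum, hψ, hψ1, hψR, hcost⟩ := exists_partition d hp hε (n : ℝ)
  -- the discretised measures, and the distance to them
  set D : ProbabilityMeasure (EuclideanSpace ℝ (Fin d)) → Measure (EuclideanSpace ℝ (Fin d)) :=
    fun ν => ∑ i, (∫⁻ x, φ i x ∂(ν : Measure (EuclideanSpace ℝ (Fin d)))) • Measure.dirac (a i)
    with hD
  have hmass (ν : ProbabilityMeasure (EuclideanSpace ℝ (Fin d))) :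
      ∑ i, ∫⁻ x, φ i x ∂(ν : Measure (EuclideanSpace ℝ (Fin d))) = 1 := by
    rw [← lintegral_finsetSum _ fun i _ => (hφ i).measurable.coe_nnreal_ennreal]
    simp_rw [← ENNReal.ofNNReal_finsetSum, hsum]
    simp
  have hDfin (ν) : IsFiniteMeasure (D ν) := by
    refine ⟨?_⟩
    simp [hD, hmass]
  have hdisc (ν : ProbabilityMeasure (EuclideanSpace ℝ (Fin d)))
      (hν : ∫⁻ x, ((ψ x * ‖x‖₊ ^ p : ℝ≥0) : ℝ≥0∞) ∂(ν : Measure (EuclideanSpace ℝ (Fin d)))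
        < (ε : ℝ≥0∞) ^ p) : wasserstein p (ν : Measure (EuclideanSpace ℝ (Fin d))) (D ν) ≤ 2 * ε := by
    refine (wasserstein_discretization_le hp _ (fun i => (hφ i).measurable) hsum a).trans ?_
    rw [one_div, ENNReal.rpow_inv_le_iff hp0]
    calc _ ≤ ∫⁻ x, ((ε : ℝ≥0∞) ^ p + ((ψ x * ‖x‖₊ ^ p : ℝ≥0) : ℝ≥0∞))
            ∂(ν : Measure (EuclideanSpace ℝ (Fin d))) := by
          refine lintegral_mono fun x => (hcost x).trans_eq ?_
          rw [ENNReal.coe_mul, hf]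
      _ ≤ (ε : ℝ≥0∞) ^ p + (ε : ℝ≥0∞) ^ p := by
          rw [lintegral_add_left measurable_const]
          simp only [lintegral_const, measure_univ, mul_one]
          gcongr
      _ ≤ (2 * ε) ^ p := by
          rw [two_mul]
          exact ENNReal.add_rpow_le_rpow_add _ _ hp
  have hμ : ∫⁻ x, ((ψ x * ‖x‖₊ ^ p : ℝ≥0) : ℝ≥0∞) ∂(μ : Measure (EuclideanSpace ℝ (Fin d)))
      < (ε : ℝ≥0∞) ^ p := by
    refine lt_of_le_of_lt ?_ hn
    rw [← lintegral_indicator (measurableSet_lt measurable_const measurable_norm)]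
    refine lintegral_mono fun x => ?_
    by_cases hx : (n : ℝ) < ‖x‖
    · rw [Set.indicator_of_mem (by simpa using hx), hf]
      exact ENNReal.coe_le_coe.2 (mul_le_of_le_one_left zero_le (hψ1 x))
    · simp [hψR x (not_lt.1 hx)]
  have htail := tendsto_lintegral_of_le h (f := fun x => ψ x * ‖x‖₊ ^ p) (k := fun x => ‖x‖₊ ^ p)
    (hψ.mul hfc) hfc (fun x => mul_le_of_le_one_left zero_le (hψ1 x))
    (by simpa only [moment, hf] using hfin) (by simpa only [moment, hf] using hlim)
  -- the weights converge since the members of the partition are bounded and continuous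
  have hφ1 (i x) : φ i x ≤ 1 :=
    hsum x ▸ Finset.single_le_sum (f := fun i => φ i x) (fun _ _ => zero_le) (Finset.mem_univ i)
  have hw (i) : Tendsto (fun j => ∫⁻ x, φ i x ∂(μs j : Measure (EuclideanSpace ℝ (Fin d)))) l
      (𝓝 (∫⁻ x, φ i x ∂(μ : Measure (EuclideanSpace ℝ (Fin d))))) :=
    tendsto_lintegral_of_le h (k := fun _ => 1) (hφ i) continuous_const (hφ1 i) (by simp)
      (by simpa using tendsto_const_nhds)
  have hwfin (i) : ∫⁻ x, φ i x ∂(μ : Measure (EuclideanSpace ℝ (Fin d))) ≠ ∞ :=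
    ne_top_of_le_ne_top ENNReal.one_ne_top
      (hmass μ ▸ Finset.single_le_sum
        (f := fun i => ∫⁻ x, φ i x ∂(μ : Measure (EuclideanSpace ℝ (Fin d))))
        (fun _ _ => zero_le) (Finset.mem_univ i))
  have hDlim : Tendsto (fun j => wasserstein p (D (μs j)) (D μ)) l (𝓝 0) := by
    refine tendsto_of_tendsto_of_tendsto_of_le_of_le tendsto_const_nhds ?_ (fun _ => zero_le)
      fun j => wasserstein_sum_dirac_le hp _ _ a (hmass (μs j)) (hmass μ)
    have hz : (0 : ℝ≥0∞) = (2 ^ (p - 1) * ∑ i : κ, (0 + 0) * ‖a i‖ₑ ^ p) ^ (1 / p) := by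
      simp [hp0]
    rw [hz]
    refine Tendsto.ennrpow_const _ (ENNReal.Tendsto.const_mul ?_ (Or.inr (two_rpow_ne_top p)))
    refine tendsto_finsetSum _ fun i _ => ENNReal.Tendsto.mul_const ?_
      (Or.inr (ENNReal.rpow_ne_top_of_nonneg hp0.le enorm_ne_top))
    refine Tendsto.add ?_ ?_
    · rw [← tsub_self (∫⁻ x, φ i x ∂(μ : Measure (EuclideanSpace ℝ (Fin d))))]
      exact ENNReal.Tendsto.sub (hw i) tendsto_const_nhds (Or.inl (hwfin i))
    · rw [← tsub_self (∫⁻ x, φ i x ∂(μ : Measure (EuclideanSpace ℝ (Fin d))))]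
      exact ENNReal.Tendsto.sub tendsto_const_nhds (hw i) (Or.inl (hwfin i))
  filter_upwards [htail.eventually_lt_const hμ,
    hDlim.eventually_lt_const (ENNReal.coe_pos.2 hε)] with j h₁ h₂
  calc wasserstein p (μs j : Measure (EuclideanSpace ℝ (Fin d))) μ
      ≤ wasserstein p (μs j : Measure (EuclideanSpace ℝ (Fin d))) (D (μs j)) +
        (wasserstein p (D (μs j)) (D μ) + wasserstein p (D μ) μ) :=
        (wasserstein_triangle hp _ (D (μs j)) _).trans
          (add_le_add_right (wasserstein_triangle hp _ (D μ) _) _)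
    _ ≤ 2 * ε + (ε + 2 * ε) := by
        gcongr
        · exact hdisc _ h₁
        · rw [wasserstein_comm hp]
          exact hdisc _ hμ
    _ = 5 * ε := by ring
    _ ≤ η := hεη.le

section Convolution

variable {γ : Measure (EuclideanSpace ℝ (Fin d))} [IsProbabilityMeasure γ]

theorem moment_conv_ne_top (hp : 1 ≤ p) (hγ : moment p γ ≠ ∞)
    {μ : Measure (EuclideanSpace ℝ (Fin d))} [IsProbabilityMeasure μ] (hμ : moment p μ ≠ ∞) :
    moment p (μ.conv γ) ≠ ∞ :=
  ne_top_of_le_ne_top (ENNReal.mul_ne_top (two_rpow_ne_top p) (ENNReal.add_ne_top.2 ⟨hμ, hγ⟩))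
    (moment_conv_le hp μ γ)

theorem eq_of_wasserstein_conv_eq_zero (hp : 1 ≤ p) (hγ : ∀ t, charFun γ t ≠ 0)
    {μ ν : Measure (EuclideanSpace ℝ (Fin d))} [IsProbabilityMeasure μ] [IsProbabilityMeasure ν]
    (h : wasserstein p (μ.conv γ) (ν.conv γ) = 0) : μ = ν := by
  refine Measure.ext_of_charFun (funext fun t => ?_)
  have := enorm_charFun_sub_le hp (μ.conv γ) (ν.conv γ) t
  rw [h, mul_zero, nonpos_iff_eq_zero, enorm_eq_zero, sub_eq_zero, charFun_conv,
    charFun_conv] at this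
  exact mul_right_cancel₀ (hγ t) this

/-- Convergence of the smoothed measures in `W_p` gives pointwise convergence of the characteristic
functions, hence weak convergence by Lévy's theorem. The non-vanishing of the characteristic
function of `γ` undoes the convolution. -/
theorem tendsto_of_tendsto_wasserstein_conv (hp : 1 ≤ p) (hγ : ∀ t, charFun γ t ≠ 0)
    {μs : ℕ → ProbabilityMeasure (EuclideanSpace ℝ (Fin d))}
    {μ : ProbabilityMeasure (EuclideanSpace ℝ (Fin d))}
    (h : Tendsto (fun n => wasserstein p ((μs n : Measure (EuclideanSpace ℝ (Fin d))).conv γ)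
      ((μ : Measure (EuclideanSpace ℝ (Fin d))).conv γ)) atTop (𝓝 0)) :
    Tendsto μs atTop (𝓝 μ) := by
  refine ProbabilityMeasure.tendsto_iff_tendsto_charFun.2 fun t => ?_
  have key : Tendsto (fun n => charFun ((μs n : Measure (EuclideanSpace ℝ (Fin d))).conv γ) t) atTop
      (𝓝 (charFun ((μ : Measure (EuclideanSpace ℝ (Fin d))).conv γ) t)) := by
    rw [tendsto_iff_edist_tendsto_0]
    have h' := ENNReal.Tendsto.const_mul (a := ‖t‖ₑ) h (Or.inr enorm_ne_top)
    rw [mul_zero] at h'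
    refine tendsto_of_tendsto_of_tendsto_of_le_of_le tendsto_const_nhds h' (fun _ => zero_le)
      fun n => ?_
    rw [edist_eq_enorm_sub]
    exact enorm_charFun_sub_le hp _ _ t
  simp_rw [charFun_conv] at key
  simpa [hγ t] using key.div_const (charFun γ t)

theorem tendsto_moment_of_tendsto_wasserstein (hp : 1 ≤ p) {ι : Type*} {l : Filter ι}
    {μs : ι → Measure (EuclideanSpace ℝ (Fin d))} {μ : Measure (EuclideanSpace ℝ (Fin d))}
    (hμ : moment p μ ≠ ∞) (h : Tendsto (fun i => wasserstein p (μs i) μ) l (𝓝 0)) :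
    Tendsto (fun i => moment p (μs i)) l (𝓝 (moment p μ)) := by
  have hp0 : 0 < p := by linarith
  have hroot : Tendsto (fun i => moment p (μs i) ^ (1 / p)) l (𝓝 (moment p μ ^ (1 / p))) := by
    have hμ' : moment p μ ^ (1 / p) ≠ ∞ := ENNReal.rpow_ne_top_of_nonneg (by positivity) hμ
    refine tendsto_of_tendsto_of_tendsto_of_le_of_le (g := fun i => moment p μ ^ (1 / p) -
      wasserstein p (μs i) μ) (h := fun i => wasserstein p (μs i) μ + moment p μ ^ (1 / p))
      ?_ ?_ (fun i => ?_) fun i => moment_rpow_le hp _ _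
    · simpa using ENNReal.Tendsto.sub tendsto_const_nhds h (Or.inl hμ')
    · simpa using h.add (tendsto_const_nhds (x := moment p μ ^ (1 / p)))
    · refine tsub_le_iff_left.2 ?_
      rw [wasserstein_comm hp]
      exact moment_rpow_le hp _ _
  have := hroot.ennrpow_const p
  simpa [← ENNReal.rpow_mul, hp0.ne'] using this

end Convolution

instance (μ : Pp d p) : IsProbabilityMeasure μ.toMeasure :=
  inferInstanceAs (IsProbabilityMeasure (μ.toProb : Measure (EuclideanSpace ℝ (Fin d))))

theorem Pp.moment_ne_top (μ : Pp d p) : moment p μ.toMeasure ≠ ∞ := μ.2.ne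

theorem Pp.ext_toMeasure {μ ν : Pp d p} (h : μ.toMeasure = ν.toMeasure) : μ = ν :=
  Subtype.ext (Subtype.ext h)

theorem topology_eq_weakMomentTopology (hp : 1 ≤ p) {γ : Measure (EuclideanSpace ℝ (Fin d))}
    [IsProbabilityMeasure γ] (hγ : moment p γ ≠ ∞) (hγ₀ : ∀ t, charFun γ t ≠ 0)
    (m : MetricSpace (Pp d p)) (hm : ∀ μ ν : Pp d p,
      m.edist μ ν = wasserstein p (μ.toMeasure.conv γ) (ν.toMeasure.conv γ)) :
    m.toUniformSpace.toTopologicalSpace = weakMomentTopology d p := by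
  refine le_antisymm (le_inf ?_ ?_) ?_
  · rw [← continuous_iff_le_induced]
    refine continuous_iff_seqContinuous.2 fun μs μ h => ?_
    rw [tendsto_iff_edist_tendsto_0] at h
    exact tendsto_of_tendsto_wasserstein_conv hp hγ₀ (h.congr fun n => hm _ _)
  · rw [← continuous_iff_le_induced]
    refine continuous_iff_seqContinuous.2 fun μs μ h => ?_
    rw [tendsto_iff_edist_tendsto_0] at h
    have h' := h.congr fun n => hm (μs n) μ
    have hμ : moment p (μ.toMeasure.conv γ) ≠ ∞ := moment_conv_ne_top hp hγ μ.moment_ne_top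
    exact tendsto_moment_of_conv hp hγ (tendsto_of_tendsto_wasserstein_conv hp hγ₀ h') hμ
      (tendsto_moment_of_tendsto_wasserstein hp hμ h')
  · refine le_of_nhds_le_nhds fun μ => ?_
    have hw : Tendsto (fun ν : Pp d p => ν.toProb) (@nhds _ (weakMomentTopology d p) μ)
        (𝓝 μ.toProb) :=
      @Continuous.tendsto _ _ (weakMomentTopology d p) _ _
        (continuous_iff_le_induced.2 inf_le_left) μ
    have hmom : Tendsto (fun ν : Pp d p => moment p ν.toMeasure)
        (@nhds _ (weakMomentTopology d p) μ) (𝓝 (moment p μ.toMeasure)) :=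
      @Continuous.tendsto _ _ (weakMomentTopology d p) _ _
        (continuous_iff_le_induced.2 inf_le_right) μ
    have hW := tendsto_wasserstein hp hw μ.moment_ne_top hmom
    refine tendsto_id'.1 (tendsto_iff_edist_tendsto_0.2 ?_)
    refine tendsto_of_tendsto_of_tendsto_of_le_of_le tendsto_const_nhds hW (fun _ => zero_le)
      fun ν => ?_
    exact (hm ν μ).trans_le (wasserstein_conv_le hp _ _ γ)

/-- Smoothing by any probability measure `γ` with finite `p`-th moment and nowhere vanishing
characteristic function turns `W_p` into a metric for the weak topology with `p`-th moments. -/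
theorem exists_metricSpace_conv (hp : 1 ≤ p) {γ : Measure (EuclideanSpace ℝ (Fin d))}
    [IsProbabilityMeasure γ] (hγ : moment p γ ≠ ∞) (hγ₀ : ∀ t, charFun γ t ≠ 0) :
    ∃ m : MetricSpace (Pp d p),
      (∀ μ ν : Pp d p,
        m.edist μ ν = wasserstein p (μ.toMeasure.conv γ) (ν.toMeasure.conv γ)) ∧
      m.toUniformSpace.toTopologicalSpace = weakMomentTopology d p := by
  let em : EMetricSpace (Pp d p) :=
    { edist μ ν := wasserstein p (μ.toMeasure.conv γ) (ν.toMeasure.conv γ)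
      edist_self μ := wasserstein_self hp _
      edist_comm μ ν := wasserstein_comm hp _ _
      edist_triangle μ ν ρ := wasserstein_triangle hp _ _ _
      eq_of_edist_eq_zero h := Pp.ext_toMeasure (eq_of_wasserstein_conv_eq_zero hp hγ₀ h) }
  let m : MetricSpace (Pp d p) := EMetricSpace.toMetricSpace fun μ ν =>
    wasserstein_ne_top hp (moment_conv_ne_top hp hγ μ.moment_ne_top)
      (moment_conv_ne_top hp hγ ν.moment_ne_top)
  exact ⟨m, fun _ _ => rfl, topology_eq_weakMomentTopology hp hγ hγ₀ m fun _ _ => rfl⟩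

/-! ### Gaussian smoothing -/

theorem posSemidef_sq_smul_one (d : ℕ) (σ : ℝ) :
    (σ ^ 2 • (1 : Matrix (Fin d) (Fin d) ℝ)).PosSemidef :=
  Matrix.PosSemidef.one.smul (sq_nonneg σ)

theorem charFun_gauss_ne_zero (σ : ℝ) (t : EuclideanSpace ℝ (Fin d)) :
    charFun (gauss d σ) t ≠ 0 := by
  rw [gauss, charFun_multivariateGaussian (posSemidef_sq_smul_one d σ)]
  exact Complex.exp_ne_zero _

instance (σ : ℝ) : IsGaussian (gauss d σ) :=
  inferInstanceAs (IsGaussian (multivariateGaussian _ _))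

theorem moment_gauss_ne_top (hp : 1 ≤ p) (σ : ℝ) : moment p (gauss d σ) ≠ ∞ := by
  have hp0 : 0 < p := by linarith
  have h := IsGaussian.memLp_id (gauss d σ) (ENNReal.ofReal p) ENNReal.ofReal_ne_top
  have := lintegral_rpow_enorm_lt_top_of_eLpNorm_lt_top (by simpa using hp0)
    ENNReal.ofReal_ne_top h.eLpNorm_lt_top
  simpa [moment, ENNReal.toReal_ofReal hp0.le] using this.ne

end SmoothWasserstein

theorem proposition1 (d : ℕ) (p : ℝ) (hp : 1 ≤ p) (σ : ℝ) (hσ : 0 ≤ σ) :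
    ∃ (m mσ : MetricSpace (SmoothWasserstein.Pp d p)),
      (∀ μ ν : SmoothWasserstein.Pp d p,
        m.edist μ ν = SmoothWasserstein.wasserstein p μ.toMeasure ν.toMeasure) ∧
      (∀ μ ν : SmoothWasserstein.Pp d p,
        mσ.edist μ ν = SmoothWasserstein.smoothWasserstein p σ μ.toMeasure ν.toMeasure) ∧
      mσ.toUniformSpace.toTopologicalSpace = m.toUniformSpace.toTopologicalSpace ∧
      mσ.toUniformSpace.toTopologicalSpace = SmoothWasserstein.weakMomentTopology d p := by
  have hp0 : 0 < p := by linarith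
  -- `W_p` itself is the case of smoothing by the Dirac mass at `0`
  obtain ⟨m, hm, htop⟩ := SmoothWasserstein.exists_metricSpace_conv hp
    (γ := Measure.dirac (0 : EuclideanSpace ℝ (Fin d))) (by simp [SmoothWasserstein.moment, hp0])
    (fun t => by simp [charFun_dirac])
  obtain ⟨mσ, hmσ, htopσ⟩ := SmoothWasserstein.exists_metricSpace_conv (d := d) hp
    (SmoothWasserstein.moment_gauss_ne_top hp σ) (SmoothWasserstein.charFun_gauss_ne_zero σ)
  exact ⟨m, mσ, fun μ ν => by rw [hm]; simp only [Measure.conv_dirac_zero], hmσ,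
    htopσ.trans htop.symm, htopσ⟩
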